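/- Let $\mathbb{F}$ be a non-Archimedean local field, let $H$ be a topological group, and let $\rho \colon H \to \mathrm{GL}(d,\mathbb{F})$ be a linear representation, i.e. a continuous homomorphism, where $\mathrm{GL}(d,\mathbb{F})$ carries the topology inherited from $\mathbb{F}$. Suppose that $H$ is compactly generated (some compact subset of $H$ generates $H$ as a group) and that for some integer $k>1$ the power map $P_k \colon H \to H$, $P_k(x)=x^k$, has dense image in $H$. Then $H$ is $\rho$-compact, i.e. $\rho(H)$ is contained in a compact subgroup of $\mathrm{GL}(d,\mathbb{F})$ (equivalently, $\rho(H)$ is relatively compact in $\mathrm{GL}(d,\mathbb{F})$). -/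

import Mathlib

/-- The `k`-th power map `x ↦ x ^ k` of a group. -/
def powerMap (G : Type*) [Group G] (k : ℕ) : G → G := fun x => x ^ k

/-- A topological group is compactly generated if some compact subset generates it as an
abstract group. -/
def IsCompactlyGeneratedGroup (G : Type*) [Group G] [TopologicalSpace G] : Prop :=
  ∃ C : Set G, IsCompact C ∧ Subgroup.closure C = ⊤

/-- A linear representation of a topological group `G` over a topological field `F`: a continuous
homomorphism `G → GL(d, F)`, where `GL(d, F)` carries the topology inherited from `F`. -/
abbrev LinearRep (G : Type*) [Group G] [TopologicalSpace G] (d : ℕ) (F : Type*) [Field F]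
    [TopologicalSpace F] : Type _ :=
  G →ₜ* Matrix.GeneralLinearGroup (Fin d) F

/-- `G` is `ρ`-compact if `ρ(G)` is contained in a compact subgroup of `GL(d, F)`. -/
def IsRepCompact {G : Type*} [Group G] [TopologicalSpace G] {d : ℕ} {F : Type*} [Field F]
    [TopologicalSpace F] (ρ : LinearRep G d F) : Prop :=
  ∃ K : Subgroup (Matrix.GeneralLinearGroup (Fin d) F),
    IsCompact (K : Set (Matrix.GeneralLinearGroup (Fin d) F)) ∧ ∀ g : G, ρ g ∈ K

/-!
The proof has two halves, joined by the characteristic polynomial.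

**Eigenvalues.** For a matrix `A` over `F`, `spectralValue A.charpoly` is the largest absolute value
`r(A)` of an eigenvalue of `A` in the algebraic closure, so `r(A ^ k) = r(A) ^ k`. In terms of the
coefficients of the characteristic polynomial, each set `{r ≤ c}` with `c > 0` is defined by
finitely many ultrametric closed balls, hence is clopen; and since the norm of `F` takes no values
slightly above `1`, there is `s > 1` such that `r(A) ≤ s` forces `r(A) ≤ 1`. If `r(ρ h) > 1`, then
density of the `k`-th powers gives `x` with `1 < r(ρ x) ^ k ≤ r(ρ h)`; repeating this produces
elements with `r` above `1` but at most `s`, a contradiction. So every `ρ h` has an integral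
characteristic polynomial (`spectralValue_charpoly_le_one_of_denseRange_pow`).

**Boundedness.** Let `ρ` be a finite-dimensional representation in which every group element
satisfies a monic polynomial of a fixed degree `D` with integral coefficients, and which is bounded
on a generating set. Then `ρ` is bounded (`Representation.IsBoundedOn.of_integral`), by induction on
the dimension.

* If `ρ` is irreducible and unbounded, consider the limits `T` of `t n • ρ (g n)` with `t n → 0`.
  By local compactness some such `T` is nonzero. They form a set stable under multiplication by
  `ρ(G)`, and rescaling the integral equations shows that each satisfies `T ^ D = 0`. For `T ≠ 0`
  of minimal rank, nilpotency of `T * ρ g` makes the rank of `T * ρ g * T` drop, so this product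
  vanishes. Hence `T` kills the span of `⋃ g, ρ g (range T)`, a nonzero invariant subspace, which is
  everything: `T = 0`, a contradiction.
* If `W` is a proper nonzero invariant subspace, then `W` and `V ⧸ W` are bounded by induction, so
  they have invariant lattices. As the generators are bounded and the lattice in `W` may be taken as
  large as needed, the sum of it and of a lift of the lattice of `V ⧸ W` is invariant under the
  generators (`Representation.IsBoundedOn.of_subrepresentation_of_quotient`).

Compact generation gives boundedness on generators, and a bounded subgroup of `GL(d, F)` is
relatively compact because `F` is a proper metric space.
-/

open Filter Topology

/-! ### Bounded representations and extensions -/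

section Bounded

variable {O F G V : Type*} [CommRing O] [Field F] [Algebra O F] [Group G]
  [AddCommGroup V] [Module F V] [Module O V] [IsScalarTower O F V]

variable (O) in
/-- A representation `ρ` over `F` is bounded on a set `S` of group elements, relative to a ring
`O` of scalars, if the `S`-orbit of each vector lies in a finitely generated `O`-submodule. When `O`
is the ring of integers of a nonarchimedean field and the dimension is finite, this says that the
matrix entries of `ρ g`, for `g ∈ S`, are bounded. -/
def Representation.IsBoundedOn (ρ : Representation F G V) (S : Set G) : Prop :=
  ∀ v : V, ∃ N : Submodule O V, N.FG ∧ ∀ g ∈ S, ρ g v ∈ N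

namespace Representation.IsBoundedOn

variable [IsNoetherianRing O] {ρ : Representation F G V}

/-- In a bounded representation, invariant finitely generated `O`-submodules can be taken
arbitrarily large. -/
theorem exists_invariant (h : IsBoundedOn O ρ Set.univ) {N : Submodule O V} (hN : N.FG) :
    ∃ Λ : Submodule O V, Λ.FG ∧ N ≤ Λ ∧ ∀ g, ∀ x ∈ Λ, ρ g x ∈ Λ := by
  induction N, hN using Submodule.fg_induction with
  | singleton v =>
    obtain ⟨N, hN, hv⟩ := h v
    have hle : Submodule.span O (Set.range fun g => ρ g v) ≤ N := by
      rw [Submodule.span_le]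
      rintro _ ⟨g, rfl⟩
      exact hv g (Set.mem_univ g)
    refine ⟨Submodule.span O (Set.range fun g => ρ g v), hN.of_le hle, ?_, fun g => ?_⟩
    · rw [Submodule.span_le, Set.singleton_subset_iff]
      exact Submodule.subset_span ⟨1, by simp⟩
    · suffices hle : Submodule.span O (Set.range fun g => ρ g v) ≤
          (Submodule.span O (Set.range fun g => ρ g v)).comap ((ρ g).restrictScalars O) from
        fun x hx => hle hx
      rw [Submodule.span_le]
      rintro _ ⟨h, rfl⟩
      exact Submodule.subset_span ⟨g * h, by simp⟩
  | sup N₁ N₂ _ _ h₁ h₂ =>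
    obtain ⟨Λ₁, f₁, l₁, i₁⟩ := h₁
    obtain ⟨Λ₂, f₂, l₂, i₂⟩ := h₂
    refine ⟨Λ₁ ⊔ Λ₂, f₁.sup f₂, sup_le_sup l₁ l₂, fun g x hx => ?_⟩
    obtain ⟨y, hy, z, hz, rfl⟩ := Submodule.mem_sup.1 hx
    rw [map_add]
    exact Submodule.add_mem_sup (i₁ g y hy) (i₂ g z hz)

/-- An extension of bounded representations is bounded as soon as it is bounded on a set of
generators. -/
theorem of_subrepresentation_of_quotient {W : Submodule F V} (hW : ∀ g, W ≤ W.comap (ρ g))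
    {C : Set G} (hC : Submonoid.closure C = ⊤) (hb : IsBoundedOn O ρ C)
    (hsub : IsBoundedOn O (ρ.subrepresentation W hW) Set.univ)
    (hquot : IsBoundedOn O (ρ.quotient W hW) Set.univ) : IsBoundedOn O ρ Set.univ := by
  intro v
  obtain ⟨s, hs⟩ := W.mkQ.exists_rightInverse_of_surjective W.range_mkQ
  have hs' (q : V ⧸ W) : W.mkQ (s q) = q := LinearMap.congr_fun hs q
  obtain ⟨Λq, hΛq, hvq, hinvq⟩ :=
    hquot.exists_invariant (Submodule.fg_span_singleton (R := O) (W.mkQ v))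
  rw [Submodule.span_le, Set.singleton_subset_iff, SetLike.mem_coe] at hvq
  obtain ⟨T, hT⟩ := id hΛq
  choose N hN hNC using hb
  let sO : (V ⧸ W) →ₗ[O] V := s.restrictScalars O
  let iO : W →ₗ[O] V := W.subtype.restrictScalars O
  -- `N₀` contains `v`, the lift `s Λq`, and all `ρ c (s q)` for `c ∈ C` and `q` a generator of `Λq`.
  -- Its trace on `W` therefore contains the defects `ρ c (s q) - s (c • q)`.
  let N₀ : Submodule O V := (T.sup fun q => N (s q)) ⊔ Λq.map sO ⊔ Submodule.span O {v}
  have hN₀ : N₀.FG :=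
    ((Submodule.fg_finset_sup T _ fun q _ => hN (s q)).sup (hΛq.map sO)).sup
      (Submodule.fg_span_singleton v)
  have hN₁ : (N₀.comap iO).FG :=
    Submodule.fg_of_fg_map_injective iO Subtype.val_injective (hN₀.of_le (Submodule.map_comap_le _ _))
  obtain ⟨Λw, hΛw, hle, hinvw⟩ := hsub.exists_invariant hN₁
  have key {x : V} (hxW : W.mkQ x = 0) (hx : x ∈ N₀) : x ∈ Λw.map iO :=
    ⟨⟨x, (Submodule.Quotient.mk_eq_zero W).1 hxW⟩, hle (show x ∈ N₀ from hx), rfl⟩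
  have hsN {q : V ⧸ W} (hq : q ∈ Λq) : s q ∈ N₀ :=
    Submodule.mem_sup_left (Submodule.mem_sup_right ⟨q, hq, rfl⟩)
  have hmk (g : G) (x : V) : W.mkQ (ρ g x) = ρ.quotient W hW g (W.mkQ x) := rfl
  let Λ : Submodule O V := Λw.map iO ⊔ Λq.map sO
  have hgen : ∀ c ∈ C, ∀ x ∈ Λ, ρ c x ∈ Λ := by
    intro c hc x hx
    obtain ⟨_, ⟨w, hw, rfl⟩, _, ⟨q, hq, rfl⟩, rfl⟩ := Submodule.mem_sup.1 hx
    rw [map_add]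
    refine Λ.add_mem (Submodule.mem_sup_left ⟨_, hinvw c w hw, rfl⟩) ?_
    -- By linearity only the generators of `Λq` need to be considered.
    suffices hle : Λq ≤ Λ.comap ((ρ c).restrictScalars O ∘ₗ sO) from hle hq
    rw [← hT, Submodule.span_le]
    intro t ht
    have htΛ : t ∈ Λq := hT ▸ Submodule.subset_span ht
    change ρ c (s t) ∈ Λ
    rw [← sub_add_cancel (ρ c (s t)) (s (ρ.quotient W hW c t))]
    refine Submodule.add_mem_sup (key ?_ ?_) ⟨_, hinvq c t htΛ, rfl⟩
    · rw [map_sub, hmk, hs', hs', sub_self]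
    · refine N₀.sub_mem (Submodule.mem_sup_left (Submodule.mem_sup_left ?_)) (hsN (hinvq c t htΛ))
      exact Finset.le_sup (f := fun q => N (s q)) ht (hNC (s t) c hc)
  have hinv (g : G) : ∀ x ∈ Λ, ρ g x ∈ Λ := by
    have hg : g ∈ Submonoid.closure C := hC ▸ Submonoid.mem_top g
    induction hg using Submonoid.closure_induction with
    | mem c hc => exact hgen c hc
    | one => simp
    | mul a b _ _ ha hb =>
      intro x hx
      rw [map_mul]
      exact ha _ (hb x hx)
  refine ⟨Λ, (hΛw.map iO).sup (hΛq.map sO), fun g _ => hinv g v ?_⟩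
  rw [← sub_add_cancel v (s (W.mkQ v))]
  refine Submodule.add_mem_sup (key ?_ ?_) ⟨_, hvq, rfl⟩
  · rw [map_sub, hs', sub_self]
  · exact N₀.sub_mem (Submodule.mem_sup_right (Submodule.mem_span_singleton_self v)) (hsN hvq)

end Representation.IsBoundedOn

end Bounded

/-! ### Coordinates of finitely generated modules over the integers -/

section Normed

theorem Submodule.exists_fg_of_norm_repr_le {O F V ι : Type*} [CommRing O]
    [NontriviallyNormedField F] [IsUltrametricDist F] [Algebra O F] [AddCommGroup V] [Module F V]
    [Module O V] [IsScalarTower O F V] [Finite ι]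
    (hO : (NormedField.valuation (K := F)).Integers O) (b : Module.Basis ι F V) {X : Set V} {M : ℝ}
    (hX : ∀ x ∈ X, ∀ i, ‖b.repr x i‖ ≤ M) : ∃ N : Submodule O V, N.FG ∧ X ⊆ N := by
  have := Fintype.ofFinite ι
  obtain ⟨a, ha⟩ := NormedField.exists_lt_norm F (max M 0)
  have ha0 : 0 < ‖a‖ := (le_max_right M 0).trans_lt ha
  refine ⟨Submodule.span O (Set.range fun i => a • b i), Submodule.fg_span (Set.finite_range _),
    fun x hx => ?_⟩
  rw [SetLike.mem_coe, ← b.sum_repr x]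
  refine Submodule.sum_mem _ fun i _ => ?_
  have h1 : ‖b.repr x i / a‖ ≤ 1 := by
    rw [norm_div]
    exact div_le_one_of_le₀ ((hX x hx i).trans ((le_max_left M 0).trans ha.le)) ha0.le
  obtain ⟨o, ho⟩ := hO.exists_of_le_one (r := b.repr x i / a) (by
    rw [NormedField.valuation_apply]; exact_mod_cast h1)
  have : b.repr x i • b i = o • a • b i := by
    rw [← algebraMap_smul F o, ho, smul_smul, div_mul_cancel₀ _ (norm_pos_iff.1 ha0)]
  rw [this]
  exact Submodule.smul_mem _ _ (Submodule.subset_span ⟨i, rfl⟩)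

theorem Submodule.FG.exists_norm_repr_le {O F V ι : Type*} [CommRing O]
    [NormedField F] [IsUltrametricDist F] [Algebra O F] [AddCommGroup V] [Module F V]
    [Module O V] [IsScalarTower O F V] [Finite ι]
    (hO : (NormedField.valuation (K := F)).Integers O) (b : Module.Basis ι F V)
    {N : Submodule O V} (hN : N.FG) : ∃ M : ℝ, ∀ x ∈ N, ∀ i, ‖b.repr x i‖ ≤ M := by
  have hO1 (o : O) : ‖algebraMap O F o‖ ≤ 1 := by
    have := hO.map_le_one o
    rw [NormedField.valuation_apply] at this
    exact_mod_cast this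
  induction N, hN using Submodule.fg_induction with
  | singleton v =>
    have := Fintype.ofFinite ι
    refine ⟨∑ i, ‖b.repr v i‖, fun x hx i => ?_⟩
    obtain ⟨o, rfl⟩ := Submodule.mem_span_singleton.1 hx
    rw [← algebraMap_smul F o, map_smul, Finsupp.smul_apply, smul_eq_mul, norm_mul]
    exact (mul_le_of_le_one_left (norm_nonneg _) (hO1 o)).trans
      (Finset.single_le_sum (f := fun i => ‖b.repr v i‖) (fun _ _ => norm_nonneg _)
        (Finset.mem_univ i))
  | sup N₁ N₂ _ _ h₁ h₂ =>
    obtain ⟨M₁, h₁⟩ := h₁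
    obtain ⟨M₂, h₂⟩ := h₂
    refine ⟨max M₁ M₂, fun x hx i => ?_⟩
    obtain ⟨y, hy, z, hz, rfl⟩ := Submodule.mem_sup.1 hx
    rw [map_add, Finsupp.add_apply]
    exact (IsUltrametricDist.norm_add_le_max _ _).trans (max_le_max (h₁ y hy i) (h₂ z hz i))

/-! ### Irreducible representations by integral matrices -/

variable {F G V : Type*} [NontriviallyNormedField F] [Group G] [AddCommGroup V] [Module F V]
  {ι : Type*} [Fintype ι] [DecidableEq ι]

namespace Representation

/-- The endomorphisms that are limits of sequences `t n • ρ (g n)` with scalars `t n → 0`. The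
convergence is that of matrices in the basis `b`; the set does not depend on `b`. -/
def degenerateLimits (ρ : Representation F G V) (b : Module.Basis ι F V) :
    Set (Module.End F V) :=
  {T | ∃ (g : ℕ → G) (t : ℕ → F), Tendsto t atTop (𝓝 0) ∧
    Tendsto (fun n => t n • LinearMap.toMatrixAlgEquiv b (ρ (g n))) atTop
      (𝓝 (LinearMap.toMatrixAlgEquiv b T))}

variable {ρ : Representation F G V} {b : Module.Basis ι F V}

theorem mul_mem_degenerateLimits {S T : Module.End F V} (hS : S ∈ ρ.degenerateLimits b)
    (hT : T ∈ ρ.degenerateLimits b) : S * T ∈ ρ.degenerateLimits b := by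
  obtain ⟨g, t, ht, hg⟩ := hS
  obtain ⟨h, s, hs, hh⟩ := hT
  refine ⟨fun n => g n * h n, fun n => t n * s n, by simpa using ht.mul hs, ?_⟩
  simpa only [map_mul, smul_mul_smul_comm] using hg.mul hh

theorem mul_apply_mem_degenerateLimits {T : Module.End F V} (hT : T ∈ ρ.degenerateLimits b)
    (h : G) : T * ρ h ∈ ρ.degenerateLimits b := by
  obtain ⟨g, t, ht, hg⟩ := hT
  refine ⟨fun n => g n * h, t, ht, ?_⟩
  simpa only [map_mul, smul_mul_assoc] using hg.mul_const (LinearMap.toMatrixAlgEquiv b (ρ h))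

/-- If each `ρ g` is a root of a monic polynomial of degree `D` with integral coefficients, then
`t • ρ g` is a root of one whose lower coefficients are of size at most `‖t‖` for `‖t‖ ≤ 1`. Letting
`t → 0`, the limit is a root of `X ^ D`. -/
theorem pow_eq_zero_of_mem_degenerateLimits {D : ℕ}
    (hint : ∀ g, ∃ c : ℕ → F, (∀ i, ‖c i‖ ≤ 1) ∧
      ∀ v, ρ (g ^ D) v = ∑ i ∈ Finset.range D, c i • ρ (g ^ i) v)
    {T : Module.End F V} (hT : T ∈ ρ.degenerateLimits b) : T ^ D = 0 := by
  obtain ⟨g, t, ht, hg⟩ := hT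
  choose c hc1 hc using hint
  apply (LinearMap.toMatrixAlgEquiv b).injective
  rw [map_pow, map_zero]
  refine tendsto_nhds_unique (hg.pow D) ?_
  have hrel (n : ℕ) : (t n • LinearMap.toMatrixAlgEquiv b (ρ (g n))) ^ D =
      ∑ i ∈ Finset.range D, (t n ^ (D - i) * c (g n) i) •
        (t n • LinearMap.toMatrixAlgEquiv b (ρ (g n))) ^ i := by
    have h1 : ρ (g n) ^ D = ∑ i ∈ Finset.range D, c (g n) i • ρ (g n) ^ i := by
      ext v
      simpa [map_pow] using hc (g n) v
    rw [smul_pow, ← map_pow, h1, map_sum, Finset.smul_sum]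
    refine Finset.sum_congr rfl fun i hi => ?_
    rw [smul_pow, map_smul, map_pow, smul_smul, smul_smul, mul_right_comm, ← pow_add,
      Nat.sub_add_cancel (Finset.mem_range.1 hi).le]
  simp_rw [hrel]
  rw [← Finset.sum_const_zero (s := Finset.range D)]
  refine tendsto_finsetSum _ fun i hi => ?_
  rw [← zero_smul F (LinearMap.toMatrixAlgEquiv b T ^ i)]
  refine Tendsto.smul ?_ (hg.pow i)
  have hpow : Tendsto (fun n => t n ^ (D - i)) atTop (𝓝 0) := by
    simpa [zero_pow (Nat.sub_pos_of_lt (Finset.mem_range.1 hi)).ne'] using ht.pow (D - i)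
  exact hpow.zero_mul_isBoundedUnder_le
    (isBoundedUnder_of ⟨1, fun n => hc1 (g n) i⟩)

/-- An unbounded representation over a locally compact field has a nonzero degenerate limit. -/
theorem exists_ne_zero_mem_degenerateLimits [ProperSpace F]
    (h : ∀ M : ℝ, ∃ g i j, M < ‖LinearMap.toMatrixAlgEquiv b (ρ g) i j‖) :
    ∃ T ∈ ρ.degenerateLimits b, T ≠ 0 := by
  -- Dividing by an entry of largest norm puts the matrix on the unit sphere for the sup norm.
  have key (n : ℕ) : ∃ (g : G) (t : F), ‖t‖ ≤ ((n : ℝ) + 1)⁻¹ ∧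
      (show ι → ι → F from t • LinearMap.toMatrixAlgEquiv b (ρ g)) ∈
        Metric.sphere (0 : ι → ι → F) 1 := by
    obtain ⟨g, i, j, hij⟩ := h (n + 1)
    have : Nonempty (ι × ι) := ⟨(i, j)⟩
    obtain ⟨⟨i₀, j₀⟩, hmax⟩ :=
      Finite.exists_max fun p : ι × ι => ‖LinearMap.toMatrixAlgEquiv b (ρ g) p.1 p.2‖
    set a := LinearMap.toMatrixAlgEquiv b (ρ g) i₀ j₀ with ha
    have hna : (n : ℝ) + 1 ≤ ‖a‖ := hij.le.trans (hmax (i, j))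
    have ha0 : 0 < ‖a‖ := lt_of_lt_of_le (by positivity) hna
    refine ⟨g, a⁻¹, ?_, ?_⟩
    · rw [norm_inv]
      gcongr
    · rw [mem_sphere_zero_iff_norm]
      refine le_antisymm ?_ ?_
      · refine (pi_norm_le_iff_of_nonneg zero_le_one).2 fun i =>
          (pi_norm_le_iff_of_nonneg zero_le_one).2 fun j => ?_
        change ‖a⁻¹ * LinearMap.toMatrixAlgEquiv b (ρ g) i j‖ ≤ 1
        rw [norm_mul, norm_inv, inv_mul_le_one₀ ha0]
        exact hmax (i, j)
      · refine le_trans ?_ ((norm_le_pi_norm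
          (show ι → F from (a⁻¹ • LinearMap.toMatrixAlgEquiv b (ρ g)) i₀) j₀).trans
          (norm_le_pi_norm (show ι → ι → F from a⁻¹ • LinearMap.toMatrixAlgEquiv b (ρ g)) i₀))
        change 1 ≤ ‖a⁻¹ * a‖
        rw [inv_mul_cancel₀ (norm_pos_iff.1 ha0), norm_one]
  choose g t ht hgt using key
  obtain ⟨A, hA, φ, hφ, hlim⟩ := (isCompact_sphere (0 : ι → ι → F) 1).tendsto_subseq hgt
  refine ⟨(LinearMap.toMatrixAlgEquiv b).symm (Matrix.of A), ⟨g ∘ φ, t ∘ φ, ?_, ?_⟩, ?_⟩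
  · refine Tendsto.comp ?_ hφ.tendsto_atTop
    refine squeeze_zero_norm ht ?_
    simpa [one_div] using tendsto_one_div_add_atTop_nhds_zero_nat (𝕜 := ℝ)
  · rw [AlgEquiv.apply_symm_apply]
    exact hlim
  · rw [Ne, EmbeddingLike.map_eq_zero_iff]
    rintro h0
    have : A = 0 := h0
    simp [this] at hA

/-- An irreducible representation whose elements satisfy integral equations of a fixed degree is
bounded. -/
theorem exists_norm_toMatrix_le_of_irreducible [ProperSpace F] (b : Module.Basis ι F V)
    (hirr : ∀ W : Submodule F V, (∀ g, W ≤ W.comap (ρ g)) → W = ⊥ ∨ W = ⊤) {D : ℕ}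
    (hint : ∀ g, ∃ c : ℕ → F, (∀ i, ‖c i‖ ≤ 1) ∧
      ∀ v, ρ (g ^ D) v = ∑ i ∈ Finset.range D, c i • ρ (g ^ i) v) :
    ∃ M : ℝ, ∀ g i j, ‖LinearMap.toMatrixAlgEquiv b (ρ g) i j‖ ≤ M := by
  have : FiniteDimensional F V := b.finiteDimensional_of_finite
  by_contra! hunb
  obtain ⟨T, ⟨hTJ, hT0⟩, hmin⟩ :=
    (measure fun T : Module.End F V => Module.finrank F (LinearMap.range T)).wf.has_min
      {T | T ∈ ρ.degenerateLimits b ∧ T ≠ 0} (exists_ne_zero_mem_degenerateLimits hunb)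
  have hTgT (g : G) : T * ρ g * T = 0 := by
    have hTg := mul_apply_mem_degenerateLimits hTJ g
    by_contra hne
    -- By minimality of the rank, `T * ρ g` maps `range T` onto itself; but it is nilpotent.
    have hrange : LinearMap.range (T * ρ g * T) = LinearMap.range T := by
      refine Submodule.eq_of_le_of_finrank_le ?_
        (not_lt.1 (hmin _ ⟨mul_mem_degenerateLimits hTg hTJ, hne⟩))
      rw [mul_assoc]
      exact LinearMap.range_comp_le_range _ _
    have hpow (m : ℕ) : LinearMap.range ((T * ρ g) ^ m * T) = LinearMap.range T := by
      induction m with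
      | zero => rw [pow_zero, one_mul]
      | succ m ih =>
        rw [pow_succ, mul_assoc, Module.End.mul_eq_comp, LinearMap.range_comp, hrange,
          ← LinearMap.range_comp, ← Module.End.mul_eq_comp, ih]
    have h0 := hpow D
    rw [pow_eq_zero_of_mem_degenerateLimits hint hTg, zero_mul, LinearMap.range_zero] at h0
    exact hT0 (LinearMap.range_eq_bot.1 h0.symm)
  let W : Submodule F V := ⨆ g, LinearMap.range (ρ g * T)
  have hWinv (h : G) : W ≤ W.comap (ρ h) := by
    refine iSup_le fun g => ?_
    rintro _ ⟨v, rfl⟩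
    refine Submodule.mem_iSup_of_mem (h * g) ⟨v, ?_⟩
    simp
  have hWT : W ≤ LinearMap.ker T := by
    refine iSup_le fun g => ?_
    rintro _ ⟨v, rfl⟩
    exact LinearMap.congr_fun (hTgT g) v
  rcases hirr W hWinv with h | h
  · refine hT0 (LinearMap.range_eq_bot.1 (le_bot_iff.1 (h ▸ ?_)))
    simpa using le_iSup (fun g => LinearMap.range (ρ g * T)) 1
  · exact hT0 (LinearMap.ker_eq_top.1 (top_le_iff.1 (h ▸ hWT)))

end Representation

/-! ### Passage to all representations -/

/-- Fixing the degree `D` of the integral equations, rather than using characteristic polynomials,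
lets the hypothesis pass to subrepresentations and quotients unchanged. -/
theorem Representation.IsBoundedOn.of_integral {O F G V : Type*} [CommRing O] [IsNoetherianRing O]
    [NontriviallyNormedField F] [IsUltrametricDist F] [ProperSpace F] [Algebra O F]
    (hO : (NormedField.valuation (K := F)).Integers O) [Group G]
    [AddCommGroup V] [Module F V] [FiniteDimensional F V] [Module O V] [IsScalarTower O F V]
    {ρ : Representation F G V} {C : Set G} (hC : Submonoid.closure C = ⊤)
    (hb : IsBoundedOn O ρ C) {D : ℕ}
    (hint : ∀ g, ∃ c : ℕ → F, (∀ i, ‖c i‖ ≤ 1) ∧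
      ∀ v, ρ (g ^ D) v = ∑ i ∈ Finset.range D, c i • ρ (g ^ i) v) :
    IsBoundedOn O ρ Set.univ := by
  induction hn : Module.finrank F V using Nat.strong_induction_on generalizing V with
  | _ n ih =>
    subst hn
    by_cases hirr : ∀ W : Submodule F V, (∀ g, W ≤ W.comap (ρ g)) → W = ⊥ ∨ W = ⊤
    · intro v
      let b := Module.finBasis F V
      obtain ⟨M, hM⟩ := exists_norm_toMatrix_le_of_irreducible b hirr hint
      obtain ⟨N, hN, hNX⟩ := Submodule.exists_fg_of_norm_repr_le hO b
        (X := Set.range fun g => ρ g v) (M := ∑ j, M * ‖b.repr v j‖) (by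
          rintro _ ⟨g, rfl⟩ i
          rw [← LinearMap.toMatrix_mulVec_repr b b (ρ g) v]
          rw [Matrix.mulVec, dotProduct]
          refine (norm_sum_le _ _).trans (Finset.sum_le_sum fun j _ => ?_)
          rw [norm_mul]
          gcongr
          exact hM g i j)
      exact ⟨N, hN, fun g _ => hNX ⟨g, rfl⟩⟩
    · push Not at hirr
      obtain ⟨W, hW, hbot, htop⟩ := hirr
      refine .of_subrepresentation_of_quotient hW hC hb (ih _ ?_ ?_ ?_ rfl) (ih _ ?_ ?_ ?_ rfl)
      · exact Submodule.finrank_lt htop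
      · intro w
        obtain ⟨N, hN, h⟩ := hb w
        exact ⟨N.comap (W.subtype.restrictScalars O), Submodule.fg_of_fg_map_injective _
          Subtype.val_injective (hN.of_le (Submodule.map_comap_le _ _)), h⟩
      · intro g
        obtain ⟨c, hc1, hc⟩ := hint g
        refine ⟨c, hc1, fun w => Subtype.ext ?_⟩
        simpa using hc w
      · have := Submodule.finrank_quotient_add_finrank W
        have : 0 < Module.finrank F W := Nat.pos_of_ne_zero fun h => hbot (Submodule.finrank_eq_zero.1 h)
        omega
      · intro q
        obtain ⟨v, rfl⟩ := W.mkQ_surjective q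
        obtain ⟨N, hN, h⟩ := hb v
        exact ⟨N.map (W.mkQ.restrictScalars O), hN.map _, fun g hg => ⟨ρ g v, h g hg, rfl⟩⟩
      · intro g
        obtain ⟨c, hc1, hc⟩ := hint g
        refine ⟨c, hc1, fun q => ?_⟩
        obtain ⟨v, rfl⟩ := W.mkQ_surjective q
        have := congrArg W.mkQ (hc v)
        rw [map_sum] at this
        exact this

end Normed

/-! ### The spectral value of a matrix -/

section Spectral

theorem spectralValue_le_iff {F : Type*} [NormedField F] {p : Polynomial F} {c : ℝ} (hc : 0 ≤ c) :
    spectralValue p ≤ c ↔ ∀ i < p.natDegree, ‖p.coeff i‖ ≤ c ^ (p.natDegree - i) := by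
  have hterm {i : ℕ} (hi : i < p.natDegree) :
      spectralValueTerms p i ≤ c ↔ ‖p.coeff i‖ ≤ c ^ (p.natDegree - i) := by
    have hpos : (0 : ℝ) < ((p.natDegree - i : ℕ) : ℝ) := by exact_mod_cast Nat.sub_pos_of_lt hi
    rw [spectralValueTerms_of_lt_natDegree _ hi, one_div, ← Nat.cast_sub hi.le,
      Real.rpow_inv_le_iff_of_pos (norm_nonneg _) hc hpos, Real.rpow_natCast]
  refine ⟨fun h i hi => (hterm hi).1 ((le_ciSup (spectralValueTerms_bddAbove p) i).trans h),
    fun h => ciSup_le fun i => ?_⟩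
  by_cases hi : i < p.natDegree
  · exact (hterm hi).2 (h i hi)
  · rwa [spectralValueTerms_of_natDegree_le _ (not_lt.1 hi)]

theorem Matrix.exists_pow_eq_sum_of_spectralValue_charpoly_le_one {F n : Type*} [NormedField F]
    [Fintype n] [DecidableEq n] (A : Matrix n n F) (hA : spectralValue A.charpoly ≤ 1) :
    ∃ c : ℕ → F, (∀ i, ‖c i‖ ≤ 1) ∧
      A ^ Fintype.card n = ∑ i ∈ Finset.range (Fintype.card n), c i • A ^ i := by
  refine ⟨fun i => -A.charpoly.coeff i, fun i => ?_, ?_⟩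
  · rw [norm_neg]
    exact (spectralValue_le_one_iff A.charpoly_monic).1 hA i
  · have h := A.aeval_self_charpoly
    rw [Polynomial.aeval_eq_sum_range, A.charpoly_natDegree_eq_dim, Finset.sum_range_succ,
      ← A.charpoly_natDegree_eq_dim, A.charpoly_monic.coeff_natDegree, one_smul,
      A.charpoly_natDegree_eq_dim] at h
    simp only [neg_smul, Finset.sum_neg_distrib]
    exact eq_neg_of_add_eq_zero_right h

variable {F n : Type*} [NormedField F] [IsUltrametricDist F] [Fintype n] [DecidableEq n]

/-- The spectral value of the characteristic polynomial is the largest norm of an eigenvalue. -/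
theorem spectralValue_charpoly_le_iff (A : Matrix n n F) {c : ℝ} (hc : 0 ≤ c) :
    spectralValue A.charpoly ≤ c ↔
      ∀ μ ∈ spectrum (AlgebraicClosure F) (A.map (algebraMap F (AlgebraicClosure F))),
        spectralNorm F (AlgebraicClosure F) μ ≤ c := by
  classical
  set L := AlgebraicClosure F
  have hmap : (A.map (algebraMap F L)).charpoly = A.charpoly.map (algebraMap F L) :=
    A.charpoly_map (algebraMap F L)
  have hroot (μ : L) : μ ∈ spectrum L (A.map (algebraMap F L)) ↔
      μ ∈ (A.charpoly.map (algebraMap F L)).roots := by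
    rw [Matrix.mem_spectrum_iff_isRoot_charpoly, hmap,
      Polynomial.mem_roots (A.charpoly_monic.map _).ne_zero]
  rw [← max_norm_root_eq_spectralValue (f := spectralAlgNorm F L) spectralAlgNorm_isPowMul
    isNonarchimedean_spectralNorm spectralAlgNorm_one A.charpoly
    (A.charpoly.map (algebraMap F L)).roots
    (by
      rw [Polynomial.mapAlg_eq_map]
      exact ((IsAlgClosed.splits _).eq_prod_roots_of_monic (A.charpoly_monic.map _)))]
  refine ⟨fun h μ hμ => ?_, fun h => ciSup_le fun μ => ?_⟩
  · refine le_trans ?_ h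
    refine le_trans ?_ (le_ciSup (Set.Finite.bddAbove ?_) μ)
    · rw [if_pos ((hroot μ).1 hμ)]; rfl
    · refine (((A.charpoly.map (algebraMap F L)).roots.toFinset.finite_toSet.image
        (spectralAlgNorm F L)).union (Set.finite_singleton 0)).subset ?_
      rintro _ ⟨x, rfl⟩
      dsimp only
      split_ifs with hx
      · exact Or.inl ⟨x, by simpa using hx, rfl⟩
      · exact Or.inr rfl
  · split_ifs with hμ
    · exact h μ ((hroot μ).2 hμ)
    · exact hc

theorem spectralValue_charpoly_pow_le_iff (A : Matrix n n F) {c : ℝ} (hc : 0 ≤ c) {k : ℕ}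
    (hk : 0 < k) : spectralValue (A ^ k).charpoly ≤ c ^ k ↔ spectralValue A.charpoly ≤ c := by
  rw [spectralValue_charpoly_le_iff _ (pow_nonneg hc k), spectralValue_charpoly_le_iff _ hc,
    Matrix.map_pow, spectrum.map_pow_of_pos _ hk]
  simp only [Set.forall_mem_image]
  refine forall₂_congr fun μ _ => ?_
  rw [isPowMul_spectralNorm μ hk, pow_le_pow_iff_left₀ (spectralNorm_nonneg μ) hc hk.ne']

theorem Matrix.continuous_charpoly_coeff {R : Type*} [CommRing R] [TopologicalSpace R]
    [IsTopologicalRing R] (i : ℕ) : Continuous fun A : Matrix n n R => A.charpoly.coeff i := by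
  have h (A : Matrix n n R) : A.charpoly.coeff i =
      MvPolynomial.eval (fun p : n × n => A p.1 p.2) ((charpoly.univ R n).coeff i) :=
    (charpoly.univ_coeff_eval₂Hom n (RingHom.id R) (fun p : n × n => A p.1 p.2) i).symm
  simp_rw [h]
  exact (MvPolynomial.continuous_eval _).comp
    (continuous_pi fun p => continuous_id.matrix_elem p.1 p.2)

theorem isClopen_setOf_spectralValue_charpoly_le {c : ℝ} (hc : 0 < c) :
    IsClopen {A : Matrix n n F | spectralValue A.charpoly ≤ c} := by
  have : {A : Matrix n n F | spectralValue A.charpoly ≤ c} = ⋂ i ∈ Set.Iio (Fintype.card n),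
      (fun A : Matrix n n F => A.charpoly.coeff i) ⁻¹'
        Metric.closedBall 0 (c ^ (Fintype.card n - i)) := by
    ext A
    simp [spectralValue_le_iff hc.le, Matrix.charpoly_natDegree_eq_dim]
  rw [this]
  exact (Set.finite_Iio _).isClopen_biInter fun i _ =>
    (IsUltrametricDist.isClopen_closedBall 0 (pow_pos hc _).ne').preimage
      (Matrix.continuous_charpoly_coeff i)

/-- The norm values above `1` of a locally compact nonarchimedean field stay away from `1`: a
closed annulus is compact. -/
theorem exists_one_lt_forall_norm_le_one [ProperSpace F] :
    ∃ q : ℝ, 1 < q ∧ ∀ x : F, ‖x‖ < q → ‖x‖ ≤ 1 := by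
  have hK : IsCompact (Metric.closedBall (0 : F) 2 \ Metric.closedBall 0 1) :=
    (isCompact_closedBall 0 2).diff (IsUltrametricDist.isOpen_closedBall 0 one_ne_zero)
  rcases (Metric.closedBall (0 : F) 2 \ Metric.closedBall 0 1).eq_empty_or_nonempty with h | h
  · refine ⟨2, one_lt_two, fun x hx => ?_⟩
    by_contra hx1
    have : x ∈ Metric.closedBall (0 : F) 2 \ Metric.closedBall 0 1 :=
      ⟨by simpa using hx.le, by simpa using hx1⟩
    simp [h] at this
  · obtain ⟨y, hy, hmin⟩ := hK.exists_isMinOn h continuous_norm.continuousOn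
    have hy1 : 1 < ‖y‖ := by simpa using hy.2
    refine ⟨min 2 ‖y‖, lt_min one_lt_two hy1, fun x hx => ?_⟩
    by_contra hx1
    have hxK : x ∈ Metric.closedBall (0 : F) 2 \ Metric.closedBall 0 1 :=
      ⟨by simpa using (hx.trans_le (min_le_left _ _)).le, by simpa using hx1⟩
    exact (hx.trans_le (min_le_right _ _)).not_ge (hmin hxK)

variable (F n) in
/-- The spectral values above `1` of matrices of a fixed size stay away from `1`. -/
theorem exists_one_lt_forall_spectralValue_charpoly_le_one [ProperSpace F] :
    ∃ s : ℝ, 1 < s ∧ ∀ A : Matrix n n F, spectralValue A.charpoly ≤ s →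
      spectralValue A.charpoly ≤ 1 := by
  obtain ⟨q, hq, hgap⟩ := exists_one_lt_forall_norm_le_one (F := F)
  obtain ⟨s, hs, hsq⟩ : ∃ s : ℝ, 1 < s ∧ s ^ Fintype.card n < q := by
    have hcont : Tendsto (fun s : ℝ => s ^ Fintype.card n) (𝓝[>] 1) (𝓝 1) := by
      simpa using ((continuous_pow (M := ℝ) (Fintype.card n)).tendsto 1).mono_left
        nhdsWithin_le_nhds
    obtain ⟨s, hs, hs'⟩ := ((hcont.eventually_lt_const hq).and self_mem_nhdsWithin).exists
    exact ⟨s, hs', hs⟩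
  refine ⟨s, hs, fun A hA => ?_⟩
  rw [spectralValue_le_iff (zero_le_one.trans hs.le)] at hA
  rw [spectralValue_le_iff zero_le_one]
  intro i hi
  rw [one_pow]
  refine hgap _ (((hA i hi).trans ?_).trans_lt hsq)
  rw [A.charpoly_natDegree_eq_dim]
  exact pow_le_pow_right₀ hs.le (Nat.sub_le _ _)

/-- If the `k`-th powers are dense in `H`, then the eigenvalues of every continuous
finite-dimensional representation of `H` have norm at most `1`. -/
theorem spectralValue_charpoly_le_one_of_denseRange_pow [ProperSpace F] {H : Type*} [Monoid H]
    [TopologicalSpace H] {k : ℕ} (hk : 1 < k) (hdense : DenseRange fun x : H => x ^ k)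
    (f : H →* Matrix n n F) (hf : Continuous f) (h : H) :
    spectralValue (f h).charpoly ≤ 1 := by
  obtain ⟨s, hs, hgap⟩ := exists_one_lt_forall_spectralValue_charpoly_le_one F n
  -- A counterexample with spectral value at most `s ^ k ^ (m + 1)` is approximated by the `k`-th
  -- power of a counterexample with spectral value at most `s ^ k ^ m`.
  have hs0 : 0 < s := zero_lt_one.trans hs
  have key (m : ℕ) : ∀ h : H, spectralValue (f h).charpoly ≤ s ^ k ^ m →
      spectralValue (f h).charpoly ≤ 1 := by
    induction m with
    | zero => simpa using fun h => hgap (f h)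
    | succ m ih =>
      intro h hh
      by_contra h1
      have hopen : IsOpen (f ⁻¹' ({A | spectralValue A.charpoly ≤ s ^ k ^ (m + 1)} \
          {A | spectralValue A.charpoly ≤ 1})) :=
        ((isClopen_setOf_spectralValue_charpoly_le (pow_pos hs0 _)).isOpen.sdiff
          (isClopen_setOf_spectralValue_charpoly_le zero_lt_one).isClosed).preimage hf
      obtain ⟨x, hx, hx1⟩ := hdense.exists_mem_open hopen ⟨h, hh, h1⟩
      simp only [Set.mem_ofPred_eq, map_pow, pow_succ k m, pow_mul] at hx hx1
      rw [spectralValue_charpoly_pow_le_iff _ (pow_nonneg hs0.le _) (zero_lt_one.trans hk)] at hx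
      refine hx1 ?_
      rw [← one_pow k, spectralValue_charpoly_pow_le_iff _ zero_le_one (zero_lt_one.trans hk)]
      exact ih x hx
  obtain ⟨m, hm⟩ := pow_unbounded_of_one_lt (spectralValue (f h).charpoly) hs
  exact key m h (hm.le.trans (pow_le_pow_right₀ hs.le (Nat.lt_pow_self hk).le))

end Spectral

/-! ### Relative compactness of the image -/

theorem Matrix.GeneralLinearGroup.isCompact_setOf_norm_le {F n : Type*} [NormedField F]
    [ProperSpace F] [Fintype n] [DecidableEq n] (M : ℝ) :
    IsCompact {g : GL n F | (∀ i j, ‖g.1 i j‖ ≤ M) ∧ ∀ i j, ‖g⁻¹.1 i j‖ ≤ M} := by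
  have hB : IsCompact {A : Matrix n n F | ∀ i j, ‖A i j‖ ≤ M} := by
    have h : IsCompact (Set.univ.pi fun _ : n => Set.univ.pi fun _ : n =>
        Metric.closedBall (0 : F) M) :=
      isCompact_univ_pi fun _ => isCompact_univ_pi fun _ => isCompact_closedBall 0 M
    simp only [Set.pi, Set.mem_univ, forall_const, mem_closedBall_zero_iff,
      Set.mem_ofPred_eq] at h
    exact h
  have := Units.isClosedEmbedding_embedProduct.isCompact_preimage
    (hB.prod (MulOpposite.opHomeomorph.symm.isClosedEmbedding.isCompact_preimage hB))
  exact this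

/-- The result over a field with a chosen norm, with `O` its ring of integers. -/
theorem isRepCompact_of_denseRange_powerMap {O F H : Type*} [NontriviallyNormedField F]
    [IsUltrametricDist F] [ProperSpace F] [CommRing O] [IsNoetherianRing O] [Algebra O F]
    (hO : (NormedField.valuation (K := F)).Integers O) [Group H] [TopologicalSpace H]
    [IsTopologicalGroup H] {d : ℕ} (ρ : LinearRep H d F) {k : ℕ} (hk : 1 < k)
    (hdense : DenseRange (powerMap H k)) (hgen : IsCompactlyGeneratedGroup H) :
    IsRepCompact ρ := by
  obtain ⟨C, hC, hCtop⟩ := hgen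
  let f : H →* Matrix (Fin d) (Fin d) F := (Units.coeHom _).comp ρ.toMonoidHom
  have hf : Continuous f := Units.continuous_val.comp ρ.continuous_toFun
  let σ : Representation F H (Fin d → F) :=
    (Matrix.toLinAlgEquiv' : Matrix (Fin d) (Fin d) F ≃ₐ[F] _).toMonoidHom.comp f
  have hσ (h : H) (v : Fin d → F) : σ h v = (f h).mulVec v := rfl
  have hmon : Submonoid.closure (C ∪ C⁻¹) = ⊤ := by
    rw [← Subgroup.closure_toSubmonoid, hCtop, Subgroup.top_toSubmonoid]
  have hbC : σ.IsBoundedOn O (C ∪ C⁻¹) := by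
    intro v
    have hcpt : IsCompact ((fun h => (f h).mulVec v) '' (C ∪ C⁻¹)) :=
      (hC.union hC.inv).image (hf.matrix_mulVec continuous_const)
    obtain ⟨M, hM⟩ := hcpt.isBounded.exists_norm_le
    obtain ⟨N, hN, hNX⟩ := Submodule.exists_fg_of_norm_repr_le hO (Pi.basisFun F (Fin d))
      (X := (fun h => (f h).mulVec v) '' (C ∪ C⁻¹)) (M := M)
      fun x hx i => (norm_le_pi_norm x i).trans (hM x hx)
    exact ⟨N, hN, fun h hh => hNX ⟨h, hh, rfl⟩⟩
  have hint (h : H) : ∃ c : ℕ → F, (∀ i, ‖c i‖ ≤ 1) ∧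
      ∀ v, σ (h ^ d) v = ∑ i ∈ Finset.range d, c i • σ (h ^ i) v := by
    obtain ⟨c, hc1, hc⟩ := (f h).exists_pow_eq_sum_of_spectralValue_charpoly_le_one
      (spectralValue_charpoly_le_one_of_denseRange_pow hk hdense f hf h)
    refine ⟨c, hc1, fun v => ?_⟩
    simp only [Fintype.card_fin] at hc
    simp only [hσ, map_pow f, hc, Matrix.sum_mulVec, Matrix.smul_mulVec]
  have hbdd := hbC.of_integral hO hmon hint
  have hcol (j : Fin d) : ∃ M : ℝ, ∀ h i, ‖f h i j‖ ≤ M := by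
    obtain ⟨N, hN, hmem⟩ := hbdd (Pi.single j 1)
    obtain ⟨M, hM⟩ := hN.exists_norm_repr_le hO (Pi.basisFun F (Fin d))
    refine ⟨M, fun h i => ?_⟩
    simpa [hσ] using hM _ (hmem h (Set.mem_univ h)) i
  choose M hM using hcol
  obtain ⟨B, hB⟩ := (Set.finite_range M).bddAbove
  have hfB (h : H) (i j : Fin d) : ‖f h i j‖ ≤ B := (hM j h i).trans (hB ⟨j, rfl⟩)
  have hcpt := Matrix.GeneralLinearGroup.isCompact_setOf_norm_le (F := F) (n := Fin d) B
  refine ⟨ρ.toMonoidHom.range.topologicalClosure, ?_, fun g =>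
    Subgroup.le_topologicalClosure _ ⟨g, rfl⟩⟩
  refine hcpt.of_isClosed_subset (Subgroup.isClosed_topologicalClosure _) ?_
  rw [Subgroup.topologicalClosure_coe]
  refine closure_minimal ?_ hcpt.isClosed
  rintro _ ⟨h, rfl⟩
  refine ⟨hfB h, ?_⟩
  rw [← map_inv]
  exact hfB h⁻¹

theorem corollary3p5 {F : Type*} [Field F] [ValuativeRel F] [TopologicalSpace F]
    [IsNonarchimedeanLocalField F] {H : Type*} [Group H] [TopologicalSpace H]
    [IsTopologicalGroup H] (d : ℕ) (ρ : LinearRep H d F)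
    (hdense : ∃ k : ℕ, 1 < k ∧ DenseRange (powerMap H k))
    (hgen : IsCompactlyGeneratedGroup H) :
    IsRepCompact ρ := by
  obtain ⟨k, hk, hdense⟩ := hdense
  -- A norm defining the given valuation and, definitionally, the given topology.
  let := IsTopologicalAddGroup.rightUniformSpace F
  have := isUniformAddGroup_of_addCommGroup (G := F)
  let hR : (Valued.v (R := F) (Γ₀ := ValuativeRel.ValueGroupWithZero F)).RankOne :=
    { hom' := ValuativeRel.IsRankLeOne.nonempty.some.emb (R := F).comp
        MonoidWithZeroHom.ValueGroup₀.embedding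
      strictMono' := ValuativeRel.IsRankLeOne.nonempty.some.strictMono.comp
        MonoidWithZeroHom.ValueGroup₀.embedding_strictMono }
  let := Valued.toNontriviallyNormedField F (ValuativeRel.ValueGroupWithZero F)
  have : ProperSpace F := .of_nontriviallyNormedField_of_weaklyLocallyCompactSpace F
  have hnorm (x : F) : NormedField.valuation x ≤ 1 ↔ ValuativeRel.valuation F x ≤ 1 :=
    Valued.toNormedField.norm_le_one_iff
  have hO : (NormedField.valuation (K := F)).Integers (ValuativeRel.valuation F).integer :=
    { hom_inj := Subtype.val_injective
      map_le_one := fun x => (hnorm x).2 x.2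
      exists_of_le_one := fun {x} hx => ⟨⟨x, (hnorm x).1 hx⟩, rfl⟩ }
  exact isRepCompact_of_denseRange_powerMap hO ρ hk hdense hgen
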